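/- Let $\mathbf H$ be the real quaternion algebra, $n\ge 1$, and let $\mathrm{SL}(n,\mathbf H)$ be the group generated by the matrices $I+bE_{ij}\in \mathrm M(n,\mathbf H)$ with $i\neq j$, $b\in\mathbf H$, where $E_{ij}$ is the matrix with entry $1$ at position $(i,j)$ and $0$ elsewhere. For $A=(a_{ij})\in \mathrm M(n,\mathbf H)$, a permutation $\sigma\in S_n$ and $x\in\{1,\dots,n\}$ lying in a cycle of $\sigma$ of length $l$ (fixed points being cycles of length $1$), put $$A_\sigma(x)=a_{x\,\sigma(x)}\,a_{\sigma(x)\,\sigma^2(x)}\cdots a_{\sigma^{l-1}(x)\,x}.$$ For $i\in\{1,\dots,n\}$ let $m_2<\dots<m_r$ be the smallest elements of the cycles of $\sigma$ that do not contain $i$ ($r$ being the total number of cycles of $\sigma$). The $i$-th row and column determinants of $A$ are $$\mathrm{rdet}_i A=\sum_{\sigma\in S_n}(-1)^{n-r}A_\sigma(i)A_\sigma(m_2)\cdots A_\sigma(m_r),\qquad \mathrm{cdet}_i A=\sum_{\sigma\in S_n}(-1)^{n-r}A_\sigma(m_r)\cdots A_\sigma(m_2)A_\sigma(i).$$ For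 Hermitian $A$ all of these $2n$ elements coincide, and $\det A$ denotes their common value. **Theorem.** Let $A\in \mathrm M(n,\mathbf H)$ be Hermitian, i.e. $A^*=A$. Then there exist $U\in \mathrm{SL}(n,\mathbf H)$ and $\mu_1,\dots,\mu_n\in\mathbf R$ such that $U A U^*=\mathrm{diag}(\mu_1,\dots,\mu_n)$. Moreover, for every such $U$ and $\mu_1,\dots,\mu_n$ one has $\det A=\mu_1\cdots\mu_n$; that is, $\mathrm{rdet}_i A=\mathrm{cdet}_i A=\mu_1\cdots\mu_n$ for all $i=1,\dots,n$. -/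

import Mathlib

open scoped Quaternion

noncomputable section

namespace QuatDet

/-- For a permutation `σ` and a starting index `x`, the product
`a_{x, σ x} * a_{σ x, σ² x} * ⋯ * a_{σ^(l-1) x, x}` of the entries of `A` along the cycle
`(x, σ x, …, σ^(l-1) x)` of `σ` through `x`, where `l` is the length of that cycle
(`l = 1`, with product `a_{x, x}`, when `x` is a fixed point). -/
def cycleProd {n : ℕ} (A : Matrix (Fin n) (Fin n) ℍ[ℝ]) (σ : Equiv.Perm (Fin n)) (x : Fin n) :
    ℍ[ℝ] :=
  ((List.range (Function.minimalPeriod σ x)).map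
    fun k => A ((σ ^ k) x) ((σ ^ (k + 1)) x)).prod

open Classical in
/-- The smallest elements of the cycles of `σ` (fixed points included as cycles of length one)
that do not contain `i`, listed in increasing order. -/
def otherLeaders {n : ℕ} (σ : Equiv.Perm (Fin n)) (i : Fin n) : List (Fin n) :=
  (List.finRange n).filter
    fun x => decide (¬ σ.SameCycle i x ∧ ∀ y, σ.SameCycle x y → x ≤ y)

/-- The `i`-th row determinant. In the monomial of `σ`, the cycle opened by `i` comes first; each
of the other cycles is opened by its smallest element, and these cycles follow from left to right
in increasing order of their smallest elements. The sign of the monomial is `(-1) ^ (n - r)`, with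
`r` the number of cycles of `σ`, that is, the sign of `σ`. -/
def rdet {n : ℕ} (A : Matrix (Fin n) (Fin n) ℍ[ℝ]) (i : Fin n) : ℍ[ℝ] :=
  ∑ σ : Equiv.Perm (Fin n), ((Equiv.Perm.sign σ : ℤ) : ℍ[ℝ]) *
    (cycleProd A σ i * ((otherLeaders σ i).map (cycleProd A σ)).prod)

/-- The `j`-th column determinant. In the monomial of `τ`, written from right to left, the cycle
that closes at `j` comes first (so it is the rightmost block
`a_{j, τ j} * ⋯ * a_{τ⁻¹ j, j}`); each of the other cycles closes at its smallest element, and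
these cycles follow from right to left in increasing order of their smallest elements. -/
def cdet {n : ℕ} (A : Matrix (Fin n) (Fin n) ℍ[ℝ]) (j : Fin n) : ℍ[ℝ] :=
  ∑ τ : Equiv.Perm (Fin n), ((Equiv.Perm.sign τ : ℤ) : ℍ[ℝ]) *
    (((otherLeaders τ j).reverse.map (cycleProd A τ)).prod * cycleProd A τ j)

/-- The unimodular group `SL(n, ℍ)`: the group generated by the elementary unimodular matrices
`P_{ij}(b) = I + b E_{ij}`, `i ≠ j`, `b ∈ ℍ`. -/
def SL (n : ℕ) : Subgroup (Matrix (Fin n) (Fin n) ℍ[ℝ])ˣ :=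
  Subgroup.closure
    {P | ∃ (i j : Fin n) (b : ℍ[ℝ]), i ≠ j ∧
      (P : Matrix (Fin n) (Fin n) ℍ[ℝ]) = 1 + Matrix.single i j b}

end QuatDet

end

/-!
For a Hermitian matrix every row and column determinant equals the real number `mooreDet A`, the
signed sum over permutations of the products of the *real parts* of the cycle products. Indeed,
reversing one cycle of a permutation keeps the sign and conjugates the product along that cycle,
so averaging over the reversal replaces the product by its real part; doing this for every cycle
makes all factors central (`sum_monomials_eq_mooreDet`). The real part of a cycle product does not
depend on where the cycle is opened, so neither the chosen index nor the order of the cycles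
matters.

`mooreDet` makes sense for all matrices, is additive in each row (`mooreDet_add_row`) and invariant
under conjugate transposition (`mooreDet_conjTranspose`). The crucial fact is
`mooreDet_eq_zero_of_row_eq_mul`: if row `i` is `b` times row `j`, and the matrix is Hermitian away
from row and column `i`, then `mooreDet` vanishes. Permutations that separate `i` from `j` are paired
with those that join them through `σ ↦ σ * swap i j`, which changes the sign. Two separate cycles
`b * p` and `q` are merged into `b * q * p`, and averaging over the reversal of `q` turns
`re (b * q * p)` into `re q * re (b * p)`, so the two kinds of permutations cancel.

Hence, for `P = 1 + b E_{ij}` and `A` Hermitian,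
`mooreDet (P A P*) = mooreDet (A P*) = mooreDet (P A) = mooreDet A`; the one-sided products are not
Hermitian, but they are Hermitian away from row and column `i`, which is all that is needed.
So `mooreDet` is invariant under congruence by `SL(n, ℍ)` (`mooreDet_congruence`), and on a real
diagonal matrix it is the product of the diagonal entries. The diagonal form itself comes from
symmetric Gaussian elimination (`exists_slCongruent_isDiagOn_univ`).
-/

namespace QuatDet

open Equiv Equiv.Perm Function

variable {n : ℕ}

/-! ### Orbits of permutations -/

theorem minimalPeriod_perm_pos (σ : Perm (Fin n)) (x : Fin n) : 0 < minimalPeriod σ x := by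
  refine IsPeriodicPt.minimalPeriod_pos (orderOf_pos σ) ?_
  rw [IsPeriodicPt, IsFixedPt, iterate_eq_pow, pow_orderOf_eq_one, one_apply]

theorem pow_minimalPeriod_apply (σ : Perm (Fin n)) (x : Fin n) :
    (σ ^ minimalPeriod σ x) x = x := by
  rw [← iterate_eq_pow]
  exact iterate_minimalPeriod

theorem pow_apply_ne_self {σ : Perm (Fin n)} {x : Fin n} {k : ℕ} (hk : k ≠ 0)
    (hlt : k < minimalPeriod σ x) : (σ ^ k) x ≠ x := by
  intro h
  refine not_isPeriodicPt_of_pos_of_lt_minimalPeriod hk hlt ?_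
  rw [IsPeriodicPt, IsFixedPt, iterate_eq_pow, h]

theorem minimalPeriod_perm_eq {σ : Perm (Fin n)} {x : Fin n} {l : ℕ} (hl : 0 < l)
    (h : (σ ^ l) x = x) (hne : ∀ k, 0 < k → k < l → (σ ^ k) x ≠ x) :
    minimalPeriod σ x = l := by
  refine le_antisymm (IsPeriodicPt.minimalPeriod_le hl ?_) (not_lt.1 fun hlt => ?_)
  · rw [IsPeriodicPt, IsFixedPt, iterate_eq_pow, h]
  · exact hne _ (minimalPeriod_perm_pos σ x) hlt (pow_minimalPeriod_apply σ x)

theorem exists_pow_lt_minimalPeriod {σ : Perm (Fin n)} {x y : Fin n} (h : σ.SameCycle x y) :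
    ∃ k < minimalPeriod σ x, (σ ^ k) x = y := by
  obtain ⟨k, rfl⟩ := h.exists_nat_pow_eq
  refine ⟨k % minimalPeriod σ x, Nat.mod_lt _ (minimalPeriod_perm_pos σ x), ?_⟩
  rw [← iterate_eq_pow, ← iterate_eq_pow, iterate_mod_minimalPeriod_eq]

theorem minimalPeriod_inv (σ : Perm (Fin n)) (x : Fin n) :
    minimalPeriod (σ⁻¹ : Perm (Fin n)) x = minimalPeriod σ x := by
  refine minimalPeriod_perm_eq (minimalPeriod_perm_pos σ x) ?_ fun k hk hlt h => ?_
  · rw [inv_pow, inv_eq_iff_eq, pow_minimalPeriod_apply]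
  · rw [inv_pow, inv_eq_iff_eq] at h
    exact pow_apply_ne_self hk.ne' hlt h.symm

theorem pow_apply_congr {σ τ : Perm (Fin n)} {x : Fin n}
    (h : ∀ y, σ.SameCycle x y → τ y = σ y) (k : ℕ) : (τ ^ k) x = (σ ^ k) x := by
  induction k with
  | zero => rfl
  | succ k ih =>
    rw [pow_succ', pow_succ', mul_apply, mul_apply, ih]
    exact h _ ⟨k, by simp⟩

theorem minimalPeriod_congr {σ τ : Perm (Fin n)} {x : Fin n}
    (h : ∀ y, σ.SameCycle x y → τ y = σ y) : minimalPeriod τ x = minimalPeriod σ x := by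
  refine minimalPeriod_perm_eq (minimalPeriod_perm_pos σ x) ?_ fun k hk hlt => ?_
  · rw [pow_apply_congr h, pow_minimalPeriod_apply]
  · rw [pow_apply_congr h]
    exact pow_apply_ne_self hk.ne' hlt

theorem sameCycle_congr {σ τ : Perm (Fin n)} {x : Fin n}
    (h : ∀ y, σ.SameCycle x y → τ y = σ y) (y : Fin n) :
    τ.SameCycle x y ↔ σ.SameCycle x y := by
  constructor
  · intro hxy
    obtain ⟨k, rfl⟩ := hxy.exists_nat_pow_eq
    exact ⟨k, by simp [pow_apply_congr h]⟩
  · intro hxy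
    obtain ⟨k, rfl⟩ := hxy.exists_nat_pow_eq
    exact ⟨k, by simp [pow_apply_congr h]⟩

open Classical in
/-- The permutation obtained from `σ` by reversing the direction of the cycle through `x`. -/
noncomputable def flipCycle (σ : Perm (Fin n)) (x : Fin n) : Perm (Fin n) :=
  σ * ((σ.cycleOf x)⁻¹ * (σ.cycleOf x)⁻¹)

theorem flipCycle_apply_of_sameCycle {σ : Perm (Fin n)} {x y : Fin n} (h : σ.SameCycle x y) :
    flipCycle σ x y = σ⁻¹ y := by
  classical
  have h1 : σ⁻¹.SameCycle x y := sameCycle_inv.2 h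
  have h2 : σ⁻¹.SameCycle x (σ⁻¹ y) := sameCycle_apply_right.2 h1
  rw [flipCycle, cycleOf_inv, mul_apply, mul_apply, h1.cycleOf_apply, h2.cycleOf_apply]
  simp

theorem flipCycle_apply_of_not_sameCycle {σ : Perm (Fin n)} {x y : Fin n}
    (h : ¬ σ.SameCycle x y) : flipCycle σ x y = σ y := by
  classical
  have h1 : ¬ σ⁻¹.SameCycle x y := fun h' => h (sameCycle_inv.1 h')
  rw [flipCycle, cycleOf_inv, mul_apply, mul_apply, cycleOf_apply_of_not_sameCycle h1,
    cycleOf_apply_of_not_sameCycle h1]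

theorem sign_flipCycle (σ : Perm (Fin n)) (x : Fin n) : sign (flipCycle σ x) = sign σ := by
  simp [flipCycle, Int.units_mul_self]

theorem flipCycle_eq_on_of_not_sameCycle {σ : Perm (Fin n)} {x y : Fin n}
    (h : ¬ σ.SameCycle x y) : ∀ z, σ.SameCycle y z → flipCycle σ x z = σ z :=
  fun _ hz => flipCycle_apply_of_not_sameCycle fun hxz => h (hxz.trans hz.symm)

theorem flipCycle_eq_on_of_sameCycle {σ : Perm (Fin n)} {x y : Fin n}
    (h : σ.SameCycle x y) : ∀ z, σ⁻¹.SameCycle y z → flipCycle σ x z = σ⁻¹ z :=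
  fun _ hz => flipCycle_apply_of_sameCycle (h.trans (sameCycle_inv.1 hz))

theorem sameCycle_flipCycle (σ : Perm (Fin n)) (x y z : Fin n) :
    (flipCycle σ x).SameCycle y z ↔ σ.SameCycle y z := by
  by_cases h : σ.SameCycle x y
  · rw [sameCycle_congr (flipCycle_eq_on_of_sameCycle h), sameCycle_inv]
  · rw [sameCycle_congr (flipCycle_eq_on_of_not_sameCycle h)]

theorem flipCycle_flipCycle (σ : Perm (Fin n)) (x : Fin n) :
    flipCycle (flipCycle σ x) x = σ := by
  ext1 y
  by_cases h : σ.SameCycle x y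
  · rw [flipCycle_apply_of_sameCycle ((sameCycle_flipCycle σ x x y).2 h), inv_eq_iff_eq,
      flipCycle_apply_of_sameCycle (sameCycle_apply_right.2 h)]
    simp
  · rw [flipCycle_apply_of_not_sameCycle (fun h' => h ((sameCycle_flipCycle σ x x y).1 h')),
      flipCycle_apply_of_not_sameCycle h]

/-! ### Products of entries along cycles -/

/-- The product of the entries of `A` along the first `l` steps of the `σ`-orbit of `x`. -/
noncomputable def walkProd (A : Matrix (Fin n) (Fin n) ℍ[ℝ]) (σ : Perm (Fin n)) (x : Fin n)
    (l : ℕ) : ℍ[ℝ] :=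
  ((List.range l).map fun k => A ((σ ^ k) x) ((σ ^ (k + 1)) x)).prod

theorem cycleProd_eq_walkProd (A : Matrix (Fin n) (Fin n) ℍ[ℝ]) (σ : Perm (Fin n)) (x : Fin n) :
    cycleProd A σ x = walkProd A σ x (minimalPeriod σ x) := rfl

theorem walkProd_congr {A B : Matrix (Fin n) (Fin n) ℍ[ℝ]} {σ τ : Perm (Fin n)} {x y : Fin n}
    {l : ℕ} (h : ∀ k < l, A ((σ ^ k) x) ((σ ^ (k + 1)) x) = B ((τ ^ k) y) ((τ ^ (k + 1)) y)) :
    walkProd A σ x l = walkProd B τ y l := by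
  refine congrArg List.prod (List.map_congr_left fun k hk => h k (List.mem_range.1 hk))

theorem walkProd_succ (A : Matrix (Fin n) (Fin n) ℍ[ℝ]) (σ : Perm (Fin n)) (x : Fin n) (l : ℕ) :
    walkProd A σ x (l + 1) = walkProd A σ x l * A ((σ ^ l) x) ((σ ^ (l + 1)) x) := by
  simp [walkProd, List.range_succ]

theorem walkProd_add (A : Matrix (Fin n) (Fin n) ℍ[ℝ]) (σ : Perm (Fin n)) (x : Fin n)
    (l m : ℕ) : walkProd A σ x (l + m) = walkProd A σ x l * walkProd A σ ((σ ^ l) x) m := by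
  induction m with
  | zero => simp [walkProd]
  | succ m ih =>
    rw [← add_assoc, walkProd_succ, ih, walkProd_succ, mul_assoc, ← mul_apply, ← mul_apply,
      ← pow_add, ← pow_add, add_comm m l, add_comm (m + 1) l, add_assoc]

theorem walkProd_succ' (A : Matrix (Fin n) (Fin n) ℍ[ℝ]) (σ : Perm (Fin n)) (x : Fin n) (l : ℕ) :
    walkProd A σ x (l + 1) = A x (σ x) * walkProd A σ (σ x) l := by
  rw [add_comm, walkProd_add]
  simp [walkProd]

theorem star_walkProd (A : Matrix (Fin n) (Fin n) ℍ[ℝ]) (σ : Perm (Fin n)) (x : Fin n) (l : ℕ) :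
    star (walkProd A σ x l) = walkProd A.conjTranspose σ⁻¹ ((σ ^ l) x) l := by
  induction l with
  | zero => simp [walkProd]
  | succ l ih =>
    rw [walkProd_succ, star_mul, ih, walkProd_succ', Matrix.conjTranspose_apply, pow_succ',
      mul_apply]
    simp

/-- The cycle opened at `x` is its first entry followed by the remaining walk back to `x`. -/
theorem cycleProd_eq_mul_walkProd (A : Matrix (Fin n) (Fin n) ℍ[ℝ]) (σ : Perm (Fin n))
    (x : Fin n) :
    cycleProd A σ x = A x (σ x) * walkProd A σ (σ x) (minimalPeriod σ x - 1) := by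
  rw [← walkProd_succ', Nat.sub_add_cancel (minimalPeriod_perm_pos σ x), cycleProd_eq_walkProd]

theorem minimalPeriod_apply_perm (σ : Perm (Fin n)) (x : Fin n) :
    minimalPeriod σ (σ x) = minimalPeriod σ x :=
  minimalPeriod_apply_iterate (mk_mem_periodicPts (minimalPeriod_perm_pos σ x)
    (isPeriodicPt_minimalPeriod σ x)) 1

theorem cycleProd_congr {A : Matrix (Fin n) (Fin n) ℍ[ℝ]} {σ τ : Perm (Fin n)} {x : Fin n}
    (h : ∀ y, σ.SameCycle x y → τ y = σ y) : cycleProd A τ x = cycleProd A σ x := by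
  rw [cycleProd_eq_walkProd, cycleProd_eq_walkProd, minimalPeriod_congr h]
  exact walkProd_congr fun k _ => by rw [pow_apply_congr h, pow_apply_congr h]

theorem cycleProd_congr_entries {A B : Matrix (Fin n) (Fin n) ℍ[ℝ]} {σ : Perm (Fin n)}
    {x : Fin n} (h : ∀ y z, σ.SameCycle x y → σ.SameCycle x z → A y z = B y z) :
    cycleProd A σ x = cycleProd B σ x := by
  rw [cycleProd_eq_walkProd, cycleProd_eq_walkProd]
  exact walkProd_congr fun k _ => h _ _ (sameCycle_pow_right.2 (SameCycle.refl σ x))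
    (sameCycle_pow_right.2 (SameCycle.refl σ x))

theorem cycleProd_inv (A : Matrix (Fin n) (Fin n) ℍ[ℝ]) (σ : Perm (Fin n)) (x : Fin n) :
    cycleProd A σ⁻¹ x = star (cycleProd A.conjTranspose σ x) := by
  rw [cycleProd_eq_walkProd, cycleProd_eq_walkProd, minimalPeriod_inv, star_walkProd,
    pow_minimalPeriod_apply, Matrix.conjTranspose_conjTranspose]

theorem cycleProd_flipCycle_of_not_sameCycle (A : Matrix (Fin n) (Fin n) ℍ[ℝ])
    {σ : Perm (Fin n)} {x y : Fin n} (h : ¬ σ.SameCycle x y) :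
    cycleProd A (flipCycle σ x) y = cycleProd A σ y :=
  cycleProd_congr (flipCycle_eq_on_of_not_sameCycle h)

theorem cycleProd_flipCycle_self {A : Matrix (Fin n) (Fin n) ℍ[ℝ]} {σ : Perm (Fin n)}
    {x : Fin n} (h : ∀ y z, σ.SameCycle x y → σ.SameCycle x z → star (A z y) = A y z) :
    cycleProd A (flipCycle σ x) x = star (cycleProd A σ x) := by
  rw [cycleProd_congr (flipCycle_eq_on_of_sameCycle (SameCycle.refl σ x)), cycleProd_inv]
  exact congrArg star (cycleProd_congr_entries h)

theorem re_mul_comm (a b : ℍ[ℝ]) : (a * b).re = (b * a).re := by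
  simp only [Quaternion.re_mul]
  ring

/-- The real part of a cycle product does not depend on where the cycle is opened. -/
theorem re_cycleProd_apply (A : Matrix (Fin n) (Fin n) ℍ[ℝ]) (σ : Perm (Fin n)) (x : Fin n) :
    (cycleProd A σ (σ x)).re = (cycleProd A σ x).re := by
  obtain ⟨l, hl⟩ := Nat.exists_eq_add_of_lt (minimalPeriod_perm_pos σ x)
  rw [zero_add] at hl
  have hx : (σ ^ (l + 1)) x = x := by rw [← hl, pow_minimalPeriod_apply]
  have h1 : (σ ^ l) (σ x) = x := by rw [← mul_apply, ← pow_succ, hx]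
  have h2 : (σ ^ (l + 1)) (σ x) = σ x := by rw [pow_succ', mul_apply, h1]
  rw [cycleProd_eq_walkProd, cycleProd_eq_walkProd, minimalPeriod_apply_perm, hl, walkProd_succ,
    walkProd_succ', h1, h2, re_mul_comm]

theorem re_cycleProd_eq_of_sameCycle (A : Matrix (Fin n) (Fin n) ℍ[ℝ]) {σ : Perm (Fin n)}
    {x y : Fin n} (h : σ.SameCycle x y) : (cycleProd A σ y).re = (cycleProd A σ x).re := by
  obtain ⟨k, rfl⟩ := h.exists_nat_pow_eq
  clear h
  induction k with
  | zero => rfl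
  | succ k ih => rw [pow_succ', mul_apply, re_cycleProd_apply, ih]

/-! ### The real determinant built from real parts of cycle products -/

open Classical in
/-- The smallest elements of the cycles of `σ`, fixed points included. -/
noncomputable def leaders (σ : Perm (Fin n)) : Finset (Fin n) :=
  {x | ∀ y, σ.SameCycle x y → x ≤ y}

theorem mem_leaders {σ : Perm (Fin n)} {x : Fin n} :
    x ∈ leaders σ ↔ ∀ y, σ.SameCycle x y → x ≤ y := by
  simp [leaders]

theorem exists_leader (σ : Perm (Fin n)) (i : Fin n) : ∃ m ∈ leaders σ, σ.SameCycle i m := by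
  classical
  obtain ⟨m, hm, hmin⟩ := Finset.exists_min_image ({x | σ.SameCycle i x} : Finset (Fin n)) id
    ⟨i, by simp [SameCycle.refl]⟩
  simp only [Finset.mem_filter, Finset.mem_univ, true_and, id] at hm hmin
  exact ⟨m, mem_leaders.2 fun y hy => hmin y (hm.trans hy), hm⟩

open Classical in
/-- In a product over the cycles of `σ`, the factor of the cycle through `i` can be split off. -/
theorem prod_leaders (σ : Perm (Fin n)) (f : Fin n → ℝ)
    (hf : ∀ x y, σ.SameCycle x y → f y = f x) (i : Fin n) :
    ∏ x ∈ leaders σ, f x = f i * ∏ x ∈ leaders σ, if σ.SameCycle i x then 1 else f x := by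
  obtain ⟨m, hm, him⟩ := exists_leader σ i
  rw [← Finset.mul_prod_erase _ _ hm, ← Finset.mul_prod_erase _ _ hm, if_pos him, one_mul,
    hf i m him]
  congr 1
  refine Finset.prod_congr rfl fun x hx => (if_neg fun hix => ?_).symm
  rw [Finset.mem_erase] at hx
  have hmx : σ.SameCycle m x := him.symm.trans hix
  exact hx.1 (le_antisymm (mem_leaders.1 hx.2 m hmx.symm) (mem_leaders.1 hm x hmx))

/-- The product over the cycles of `σ` of the real parts of the cycle products of `A`. -/
noncomputable def cycleRe (A : Matrix (Fin n) (Fin n) ℍ[ℝ]) (σ : Perm (Fin n)) : ℝ :=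
  ∏ x ∈ leaders σ, (cycleProd A σ x).re

/-- The signed sum over all permutations of the products of the real parts of the cycle products.
It is defined for every matrix; on Hermitian matrices it is the common value of the row and
column determinants. -/
noncomputable def mooreDet (A : Matrix (Fin n) (Fin n) ℍ[ℝ]) : ℝ :=
  ∑ σ : Perm (Fin n), ((sign σ : ℤ) : ℝ) * cycleRe A σ

open Classical in
theorem cycleRe_eq_mul_prod (A : Matrix (Fin n) (Fin n) ℍ[ℝ]) (σ : Perm (Fin n)) (i : Fin n) :
    cycleRe A σ = (cycleProd A σ i).re *
      ∏ x ∈ leaders σ, if σ.SameCycle i x then 1 else (cycleProd A σ x).re :=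
  prod_leaders σ _ (fun _ _ h => re_cycleProd_eq_of_sameCycle A h) i

open Classical in
theorem cycleRe_eq_mul_mul_prod (A : Matrix (Fin n) (Fin n) ℍ[ℝ]) {σ : Perm (Fin n)}
    {i j : Fin n} (h : ¬ σ.SameCycle i j) :
    cycleRe A σ = (cycleProd A σ i).re * (cycleProd A σ j).re *
      ∏ x ∈ leaders σ, if σ.SameCycle i x ∨ σ.SameCycle j x then 1 else (cycleProd A σ x).re := by
  rw [cycleRe_eq_mul_prod A σ i, mul_assoc, prod_leaders σ _ _ j, if_neg h]
  · congr 2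
    refine Finset.prod_congr rfl fun x _ => ?_
    by_cases h1 : σ.SameCycle i x <;> by_cases h2 : σ.SameCycle j x <;> simp [h1, h2]
  · intro x y hxy
    have : σ.SameCycle i y ↔ σ.SameCycle i x := ⟨fun h => h.trans hxy.symm, fun h => h.trans hxy⟩
    simp only [this, re_cycleProd_eq_of_sameCycle A hxy]

theorem mooreDet_conjTranspose (A : Matrix (Fin n) (Fin n) ℍ[ℝ]) :
    mooreDet A.conjTranspose = mooreDet A := by
  unfold mooreDet
  refine Fintype.sum_equiv (Equiv.inv _) _ _ fun σ => ?_
  have hl : leaders σ⁻¹ = leaders σ := by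
    ext x
    simp only [mem_leaders, sameCycle_inv]
  simp only [Equiv.inv_apply, sign_inv, cycleRe, hl, cycleProd_inv, Quaternion.re_star]

theorem cycleRe_add_row {A B C : Matrix (Fin n) (Fin n) ℍ[ℝ]} {i : Fin n}
    (hi : ∀ y, C i y = A i y + B i y) (hA : ∀ x, x ≠ i → ∀ y, C x y = A x y)
    (hB : ∀ x, x ≠ i → ∀ y, C x y = B x y) (σ : Perm (Fin n)) :
    cycleRe C σ = cycleRe A σ + cycleRe B σ := by
  classical
  have hprod : ∀ D : Matrix (Fin n) (Fin n) ℍ[ℝ], (∀ x, x ≠ i → ∀ y, C x y = D x y) →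
      (∏ x ∈ leaders σ, if σ.SameCycle i x then 1 else (cycleProd C σ x).re) =
        ∏ x ∈ leaders σ, if σ.SameCycle i x then 1 else (cycleProd D σ x).re := by
    intro D hD
    refine Finset.prod_congr rfl fun x _ => ?_
    split_ifs with h
    · rfl
    · rw [cycleProd_congr_entries fun y z hy _ => hD y (fun hyi => h (hyi ▸ hy.symm)) z]
  have hwalk : ∀ D : Matrix (Fin n) (Fin n) ℍ[ℝ], (∀ x, x ≠ i → ∀ y, C x y = D x y) →
      walkProd C σ (σ i) (minimalPeriod σ i - 1) = walkProd D σ (σ i) (minimalPeriod σ i - 1) := by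
    intro D hD
    refine walkProd_congr fun k hk => hD _ ?_ _
    rw [← mul_apply, ← pow_succ]
    exact pow_apply_ne_self k.succ_ne_zero (by omega)
  rw [cycleRe_eq_mul_prod A σ i, cycleRe_eq_mul_prod B σ i, cycleRe_eq_mul_prod C σ i,
    cycleProd_eq_mul_walkProd A, cycleProd_eq_mul_walkProd B, cycleProd_eq_mul_walkProd C,
    ← hprod A hA, ← hprod B hB, ← hwalk A hA, ← hwalk B hB, hi, add_mul, Quaternion.re_add, add_mul]

theorem mooreDet_add_row {A B C : Matrix (Fin n) (Fin n) ℍ[ℝ]} {i : Fin n}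
    (hi : ∀ y, C i y = A i y + B i y) (hA : ∀ x, x ≠ i → ∀ y, C x y = A x y)
    (hB : ∀ x, x ≠ i → ∀ y, C x y = B x y) : mooreDet C = mooreDet A + mooreDet B := by
  simp only [mooreDet, cycleRe_add_row hi hA hB, mul_add, Finset.sum_add_distrib]

theorem mooreDet_diagonal (μ : Fin n → ℝ) :
    mooreDet (Matrix.diagonal fun i => (μ i : ℍ[ℝ])) = ∏ k, μ k := by
  rw [mooreDet, Finset.sum_eq_single 1]
  · have hl : leaders (1 : Perm (Fin n)) = Finset.univ := by
      ext x
      simp [mem_leaders]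
    simp [cycleRe, hl, cycleProd]
  · intro σ _ hσ
    obtain ⟨x, hx⟩ : ∃ x, σ x ≠ x := by
      by_contra! h
      exact hσ (Equiv.ext h)
    rw [cycleRe_eq_mul_prod _ σ x, cycleProd_eq_mul_walkProd, Matrix.diagonal_apply_ne _ hx.symm]
    simp
  · simp

/-! ### Row and column determinants of Hermitian matrices -/

theorem prod_otherLeaders (A : Matrix (Fin n) (Fin n) ℍ[ℝ]) (σ : Perm (Fin n)) (i : Fin n) :
    ((i :: otherLeaders σ i).map fun x => (cycleProd A σ x).re).prod = cycleRe A σ := by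
  classical
  rw [cycleRe_eq_mul_prod A σ i, List.map_cons, List.prod_cons, ← List.prod_toFinset]
  · congr 1
    have : (otherLeaders σ i).toFinset = (leaders σ).filter fun x => ¬ σ.SameCycle i x := by
      ext x
      simp [otherLeaders, mem_leaders, and_comm]
    rw [this, Finset.prod_filter]
    refine Finset.prod_congr rfl fun x _ => ?_
    by_cases h : σ.SameCycle i x <;> simp [h]
  · exact (List.nodup_finRange n).filter _

theorem otherLeaders_pairwise (σ : Perm (Fin n)) (i : Fin n) :
    (i :: otherLeaders σ i).Pairwise fun x y => ¬ σ.SameCycle x y := by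
  classical
  rw [List.pairwise_cons]
  refine ⟨fun x hx => ?_, ?_⟩
  · simp only [otherLeaders, List.mem_filter, decide_eq_true_eq] at hx
    exact hx.2.1
  · refine ((List.nodup_finRange n).filter _).imp_of_mem fun {x y} hx hy hne hxy => hne ?_
    simp only [otherLeaders, List.mem_filter, decide_eq_true_eq] at hx hy
    exact le_antisymm (hx.2.2 y hxy) (hy.2.2 x hxy.symm)

theorem otherLeaders_flipCycle (σ : Perm (Fin n)) (x i : Fin n) :
    otherLeaders (flipCycle σ x) i = otherLeaders σ i := by
  simp only [otherLeaders, sameCycle_flipCycle]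

/-- The cycle products of `A` with those opened in `T` replaced by their real parts. -/
noncomputable def partialRe (A : Matrix (Fin n) (Fin n) ℍ[ℝ]) (T : Finset (Fin n))
    (σ : Perm (Fin n)) (x : Fin n) : ℍ[ℝ] :=
  if x ∈ T then ((cycleProd A σ x).re : ℍ[ℝ]) else cycleProd A σ x

/-- Reversing the cycle through `x` conjugates its product and leaves the other factors alone, so
in the sum of the two monomials that product may be replaced by its real part. -/
theorem partialRe_insert_add_flipCycle {A : Matrix (Fin n) (Fin n) ℍ[ℝ]} (hA : A.IsHermitian)
    (T : Finset (Fin n)) (x : Fin n) (σ : Perm (Fin n)) (l : List (Fin n))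
    (hl : l.Pairwise fun x y => ¬ σ.SameCycle x y) :
    (l.map (partialRe A T σ)).prod + (l.map (partialRe A T (flipCycle σ x))).prod =
      (l.map (partialRe A (insert x T) σ)).prod +
        (l.map (partialRe A (insert x T) (flipCycle σ x))).prod := by
  have hself : cycleProd A (flipCycle σ x) x = star (cycleProd A σ x) :=
    cycleProd_flipCycle_self fun y z _ _ => hA.apply y z
  -- Away from the cycle through `x` all four factors agree.
  have hoff : ∀ y, ¬ σ.SameCycle x y →
      partialRe A (insert x T) σ y = partialRe A T σ y ∧
      partialRe A T (flipCycle σ x) y = partialRe A T σ y ∧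
      partialRe A (insert x T) (flipCycle σ x) y = partialRe A T σ y := by
    intro y hy
    have hyx : y ≠ x := fun h => hy (h ▸ SameCycle.refl σ y)
    simp only [partialRe, cycleProd_flipCycle_of_not_sameCycle A hy, Finset.mem_insert, hyx,
      false_or, and_self]
  have hre : ∀ τ, partialRe A (insert x T) τ x = ((cycleProd A τ x).re : ℍ[ℝ]) := fun τ => by
    simp [partialRe]
  by_cases hx : x ∈ l
  · obtain ⟨l₁, l₂, rfl⟩ := List.append_of_mem hx
    rw [List.pairwise_append, List.pairwise_cons] at hl
    have h₁ : ∀ y ∈ l₁, ¬ σ.SameCycle x y := fun y hy h =>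
      hl.2.2 y hy x (by simp) h.symm
    have h₂ : ∀ y ∈ l₂, ¬ σ.SameCycle x y := hl.2.1.1
    have hc : ∀ l' : List (Fin n), (∀ y ∈ l', ¬ σ.SameCycle x y) →
        l'.map (partialRe A (insert x T) σ) = l'.map (partialRe A T σ) ∧
        l'.map (partialRe A T (flipCycle σ x)) = l'.map (partialRe A T σ) ∧
        l'.map (partialRe A (insert x T) (flipCycle σ x)) = l'.map (partialRe A T σ) := by
      intro l' h
      exact ⟨List.map_congr_left fun y hy => (hoff y (h y hy)).1,
        List.map_congr_left fun y hy => (hoff y (h y hy)).2.1,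
        List.map_congr_left fun y hy => (hoff y (h y hy)).2.2⟩
    have hsum : partialRe A T σ x + partialRe A T (flipCycle σ x) x =
        ((cycleProd A σ x).re : ℍ[ℝ]) + ((cycleProd A σ x).re : ℍ[ℝ]) := by
      by_cases hT : x ∈ T
      · simp [partialRe, hT, hself]
      · simp [partialRe, hT, hself, Quaternion.self_add_star, two_mul]
    simp only [List.map_append, List.map_cons, List.prod_append, List.prod_cons, hc l₁ h₁,
      hc l₂ h₂, hre, hself, Quaternion.re_star]
    rw [← mul_add, ← add_mul, hsum, add_mul, mul_add]
  · have hT : ∀ τ, l.map (partialRe A (insert x T) τ) = l.map (partialRe A T τ) := by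
      intro τ
      refine List.map_congr_left fun y hy => ?_
      have hyx : y ≠ x := fun h => hx (h ▸ hy)
      simp [partialRe, hyx]
    rw [hT, hT]

/-- For a Hermitian matrix, the cycle products in a signed sum of monomials may be replaced by
their real parts, whatever the order in which the cycles are multiplied, as long as that order
depends only on the partition into cycles. -/
theorem sum_monomials_eq_mooreDet {A : Matrix (Fin n) (Fin n) ℍ[ℝ]} (hA : A.IsHermitian)
    (L : Perm (Fin n) → List (Fin n)) (hflip : ∀ σ x, L (flipCycle σ x) = L σ)
    (hL : ∀ σ, (L σ).Pairwise fun x y => ¬ σ.SameCycle x y)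
    (hprod : ∀ σ, ((L σ).map fun x => (cycleProd A σ x).re).prod = cycleRe A σ) :
    ∑ σ : Perm (Fin n), ((sign σ : ℤ) : ℍ[ℝ]) * ((L σ).map (cycleProd A σ)).prod =
      (mooreDet A : ℍ[ℝ]) := by
  have key : ∀ T : Finset (Fin n),
      ∑ σ : Perm (Fin n), ((sign σ : ℤ) : ℍ[ℝ]) * ((L σ).map (cycleProd A σ)).prod =
      ∑ σ : Perm (Fin n), ((sign σ : ℤ) : ℍ[ℝ]) * ((L σ).map (partialRe A T σ)).prod := by
    intro T
    induction T using Finset.induction_on with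
    | empty =>
      have h0 (σ : Perm (Fin n)) : partialRe A ∅ σ = cycleProd A σ := by
        ext1 x
        simp [partialRe]
      simp only [h0]
    | insert x T _ ih =>
      rw [ih, ← sub_eq_zero, ← Finset.sum_sub_distrib]
      have hcancel : ∀ σ : Perm (Fin n),
          (((sign σ : ℤ) : ℍ[ℝ]) * ((L σ).map (partialRe A T σ)).prod -
            ((sign σ : ℤ) : ℍ[ℝ]) * ((L σ).map (partialRe A (insert x T) σ)).prod) +
          (((sign (flipCycle σ x) : ℤ) : ℍ[ℝ]) *
              ((L (flipCycle σ x)).map (partialRe A T (flipCycle σ x))).prod -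
            ((sign (flipCycle σ x) : ℤ) : ℍ[ℝ]) *
              ((L (flipCycle σ x)).map (partialRe A (insert x T) (flipCycle σ x))).prod) = 0 := by
        intro σ
        rw [sign_flipCycle, hflip, ← mul_sub, ← mul_sub, ← mul_add, sub_add_sub_comm,
          partialRe_insert_add_flipCycle hA T x σ (L σ) (hL σ), sub_self, mul_zero]
      refine Finset.sum_involution (fun σ _ => flipCycle σ x) (fun σ _ => hcancel σ)
        (fun σ _ hne hfix => hne ?_) (fun _ _ => Finset.mem_univ _)
        (fun σ _ => flipCycle_flipCycle σ x)
      have := hcancel σ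
      rw [hfix] at this
      rw [← two_smul ℝ, smul_eq_zero] at this
      exact this.resolve_left two_ne_zero
  have hcoe (l : List (Fin n)) (f : Fin n → ℝ) :
      (l.map fun x => (f x : ℍ[ℝ])).prod = (((l.map f).prod : ℝ) : ℍ[ℝ]) := by
    induction l with
    | nil => simp
    | cons a l ih => simp [ih]
  have hsum : (mooreDet A : ℍ[ℝ]) =
      ∑ σ : Perm (Fin n), ((((sign σ : ℤ) : ℝ) * cycleRe A σ : ℝ) : ℍ[ℝ]) := by
    rw [mooreDet]
    exact map_sum (algebraMap ℝ ℍ[ℝ]) _ _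
  rw [key Finset.univ, hsum]
  refine Finset.sum_congr rfl fun σ _ => ?_
  have huniv : partialRe A Finset.univ σ = fun x => ((cycleProd A σ x).re : ℍ[ℝ]) := by
    ext1 x
    simp [partialRe]
  rw [huniv, hcoe, hprod, Quaternion.coe_mul]
  norm_cast

theorem rdet_eq_mooreDet {A : Matrix (Fin n) (Fin n) ℍ[ℝ]} (hA : A.IsHermitian) (i : Fin n) :
    rdet A i = (mooreDet A : ℍ[ℝ]) := by
  rw [← sum_monomials_eq_mooreDet hA (fun σ => i :: otherLeaders σ i)
    (fun σ x => by rw [otherLeaders_flipCycle]) (fun σ => otherLeaders_pairwise σ i)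
    fun σ => prod_otherLeaders A σ i]
  simp only [rdet, List.map_cons, List.prod_cons]

theorem cdet_eq_mooreDet {A : Matrix (Fin n) (Fin n) ℍ[ℝ]} (hA : A.IsHermitian) (i : Fin n) :
    cdet A i = (mooreDet A : ℍ[ℝ]) := by
  rw [← sum_monomials_eq_mooreDet hA (fun σ => (i :: otherLeaders σ i).reverse)
    (fun σ x => by rw [otherLeaders_flipCycle])
    (fun σ => List.pairwise_reverse.2 ((otherLeaders_pairwise σ i).imp fun h h' => h h'.symm))
    fun σ => by rw [List.map_reverse, List.prod_reverse, prod_otherLeaders]]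
  simp only [cdet, List.reverse_cons, List.map_append, List.prod_append, List.map_cons,
    List.map_nil, List.prod_cons, List.prod_nil, mul_one]

/-! ### Merging and splitting cycles with a transposition -/

theorem mul_swap_pow_apply {σ : Perm (Fin n)} {i j : Fin n} {m : ℕ}
    (h : ∀ k, 0 < k → k < m → (σ ^ k) j ≠ i ∧ (σ ^ k) j ≠ j) {k : ℕ} (hk : 0 < k) (hkm : k ≤ m) :
    ((σ * swap i j) ^ k) i = (σ ^ k) j := by
  induction k, hk using Nat.le_induction with
  | base => simp
  | succ k hk ih =>
    obtain ⟨h1, h2⟩ := h k hk hkm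
    rw [pow_succ', mul_apply, ih (by omega), mul_apply, swap_apply_of_ne_of_ne h1 h2, pow_succ',
      mul_apply]

theorem mul_swap_pow_apply_left {σ : Perm (Fin n)} {i j : Fin n} (h : ¬ σ.SameCycle i j)
    {k : ℕ} (hk : 0 < k) (hkm : k ≤ minimalPeriod σ j) :
    ((σ * swap i j) ^ k) i = (σ ^ k) j :=
  mul_swap_pow_apply (fun k hk hlt => ⟨fun hki => h (SameCycle.symm ⟨k, by simpa using hki⟩),
    pow_apply_ne_self hk.ne' hlt⟩) hk hkm

theorem mul_swap_pow_apply_right {σ : Perm (Fin n)} {i j : Fin n} (h : ¬ σ.SameCycle i j)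
    {k : ℕ} (hk : 0 < k) (hkm : k ≤ minimalPeriod σ i) :
    ((σ * swap i j) ^ k) j = (σ ^ k) i := by
  rw [swap_comm]
  exact mul_swap_pow_apply_left (fun h' => h h'.symm) hk hkm

theorem mul_swap_pow_minimalPeriod {σ : Perm (Fin n)} {i j : Fin n} (h : ¬ σ.SameCycle i j) :
    ((σ * swap i j) ^ minimalPeriod σ j) i = j := by
  rw [mul_swap_pow_apply_left h (minimalPeriod_perm_pos σ j) le_rfl, pow_minimalPeriod_apply]

theorem sameCycle_mul_swap {σ : Perm (Fin n)} {i j : Fin n} (h : ¬ σ.SameCycle i j) :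
    (σ * swap i j).SameCycle i j :=
  ⟨minimalPeriod σ j, by simpa using mul_swap_pow_minimalPeriod h⟩

theorem not_sameCycle_mul_swap {σ : Perm (Fin n)} {i j : Fin n} (hij : i ≠ j)
    (h : σ.SameCycle i j) : ¬ (σ * swap i j).SameCycle i j := by
  classical
  have hex := exists_pow_lt_minimalPeriod h.symm
  obtain ⟨hlt, hm⟩ := Nat.find_spec hex
  set m := Nat.find hex
  have hmin : ∀ k, 0 < k → k < m → (σ ^ k) j ≠ i ∧ (σ ^ k) j ≠ j := fun k hk hkm =>
    ⟨fun hki => Nat.find_min hex hkm ⟨hkm.trans hlt, hki⟩,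
      pow_apply_ne_self hk.ne' (hkm.trans hlt)⟩
  have hm0 : 0 < m := by
    refine Nat.pos_of_ne_zero fun h0 => hij ?_
    rw [h0] at hm
    exact hm.symm
  have hperiod : minimalPeriod (σ * swap i j : Perm (Fin n)) i ≤ m := by
    refine IsPeriodicPt.minimalPeriod_le hm0 ?_
    rw [IsPeriodicPt, IsFixedPt, iterate_eq_pow, mul_swap_pow_apply hmin hm0 le_rfl, hm]
  intro hsame
  obtain ⟨k, hk, hkj⟩ := exists_pow_lt_minimalPeriod hsame
  rcases Nat.eq_zero_or_pos k with rfl | hk0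
  · exact hij hkj
  · rw [mul_swap_pow_apply hmin hk0 (by omega)] at hkj
    exact (hmin k hk0 (by omega)).2 hkj

theorem minimalPeriod_mul_swap {σ : Perm (Fin n)} {i j : Fin n} (h : ¬ σ.SameCycle i j) :
    minimalPeriod (σ * swap i j : Perm (Fin n)) i = minimalPeriod σ j + minimalPeriod σ i := by
  have hi := minimalPeriod_perm_pos σ i
  have hj := minimalPeriod_perm_pos σ j
  refine minimalPeriod_perm_eq (by omega) ?_ fun k hk hlt => ?_
  · rw [add_comm, pow_add, mul_apply, mul_swap_pow_minimalPeriod h,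
      mul_swap_pow_apply_right h hi le_rfl, pow_minimalPeriod_apply]
  · rcases le_or_gt k (minimalPeriod σ j) with hkj | hkj
    · rw [mul_swap_pow_apply_left h hk hkj]
      exact fun h' => h (SameCycle.symm ⟨k, by simpa using h'⟩)
    · obtain ⟨m, rfl⟩ := Nat.exists_eq_add_of_lt hkj
      rw [add_assoc, add_comm, pow_add, mul_apply, mul_swap_pow_minimalPeriod h,
        mul_swap_pow_apply_right h m.succ_pos (by omega)]
      exact pow_apply_ne_self m.succ_ne_zero (by omega)

theorem mul_swap_eq_on {σ : Perm (Fin n)} {i j x : Fin n} (hi : ¬ σ.SameCycle i x)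
    (hj : ¬ σ.SameCycle j x) : ∀ y, σ.SameCycle x y → (σ * swap i j) y = σ y := by
  intro y hy
  rw [mul_apply, swap_apply_of_ne_of_ne]
  · exact fun h => hi (h ▸ hy.symm)
  · exact fun h => hj (h ▸ hy.symm)

theorem sameCycle_mul_swap_iff {σ : Perm (Fin n)} {i j : Fin n} (h : ¬ σ.SameCycle i j)
    (x : Fin n) : (σ * swap i j).SameCycle i x ↔ σ.SameCycle i x ∨ σ.SameCycle j x := by
  constructor
  · intro hx
    by_contra! hne
    exact hne.1 ((sameCycle_congr (mul_swap_eq_on hne.1 hne.2) i).1 hx.symm).symm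
  · rintro (hx | hx)
    · obtain ⟨k, hk, rfl⟩ := exists_pow_lt_minimalPeriod hx
      rcases Nat.eq_zero_or_pos k with rfl | hk0
      · exact SameCycle.refl _ _
      · rw [← mul_swap_pow_apply_right h hk0 hk.le, sameCycle_pow_right]
        exact sameCycle_mul_swap h
    · obtain ⟨k, hk, rfl⟩ := exists_pow_lt_minimalPeriod hx
      rcases Nat.eq_zero_or_pos k with rfl | hk0
      · exact sameCycle_mul_swap h
      · rw [← mul_swap_pow_apply_left h hk0 hk.le, sameCycle_pow_right]

open Classical in
theorem cycleRe_mul_swap (A : Matrix (Fin n) (Fin n) ℍ[ℝ]) {σ : Perm (Fin n)} {i j : Fin n}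
    (h : ¬ σ.SameCycle i j) :
    cycleRe A (σ * swap i j) = (cycleProd A (σ * swap i j) i).re *
      ∏ x ∈ leaders σ, if σ.SameCycle i x ∨ σ.SameCycle j x then 1 else (cycleProd A σ x).re := by
  rw [cycleRe_eq_mul_prod A _ i, leaders, leaders, Finset.prod_filter, Finset.prod_filter]
  congr 1
  refine Finset.prod_congr rfl fun x _ => ?_
  simp only [sameCycle_mul_swap_iff h]
  by_cases hx : σ.SameCycle i x ∨ σ.SameCycle j x
  · simp only [hx, if_true, ite_self]
  · rw [not_or] at hx
    have hon := mul_swap_eq_on hx.1 hx.2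
    simp only [hx.1, hx.2, or_self, if_false, sameCycle_congr hon, cycleProd_congr hon]

theorem walkProd_eq_of_pow_apply_eq (A : Matrix (Fin n) (Fin n) ℍ[ℝ]) {σ τ : Perm (Fin n)}
    {x y : Fin n} {m : ℕ} (hm : 0 < m) (h : ∀ k, 0 < k → k ≤ m → (τ ^ k) x = (σ ^ k) y) :
    walkProd A τ x m = A x (σ y) * walkProd A σ (σ y) (m - 1) := by
  obtain ⟨m, rfl⟩ : ∃ l, m = l + 1 := ⟨m - 1, by omega⟩
  have h1 : τ x = σ y := by simpa using h 1 one_pos hm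
  rw [walkProd_succ', Nat.add_sub_cancel, h1]
  congr 1
  have hk (k : ℕ) (hk : k ≤ m) : (τ ^ k) (σ y) = (σ ^ k) (σ y) := by
    rw [← h1, ← mul_apply, ← pow_succ, h _ k.succ_pos (by omega), pow_succ, mul_apply, h1]
  exact walkProd_congr fun k hkm => by rw [hk k hkm.le, hk (k + 1) hkm]

/-- When row `i` of `A` is `b` times row `j`, merging the cycles `b * p` through `i` and `q`
through `j` gives the cycle `b * q * p`. -/
theorem cycleProd_mul_swap {A : Matrix (Fin n) (Fin n) ℍ[ℝ]} {i j : Fin n} {b : ℍ[ℝ]}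
    (hrow : ∀ y, A i y = b * A j y) {σ : Perm (Fin n)} (h : ¬ σ.SameCycle i j) :
    cycleProd A (σ * swap i j) i = b * cycleProd A σ j *
      (A j (σ i) * walkProd A σ (σ i) (minimalPeriod σ i - 1)) := by
  rw [cycleProd_eq_walkProd, minimalPeriod_mul_swap h, walkProd_add, mul_swap_pow_minimalPeriod h,
    walkProd_eq_of_pow_apply_eq A (minimalPeriod_perm_pos σ j)
      (fun k hk hkm => mul_swap_pow_apply_left h hk hkm),
    walkProd_eq_of_pow_apply_eq A (minimalPeriod_perm_pos σ i)
      (fun k hk hkm => mul_swap_pow_apply_right h hk hkm),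
    hrow, cycleProd_eq_mul_walkProd A σ j, mul_assoc b]

/-! ### Invariance under unimodular congruence -/

theorem cycleRe_flipCycle {A : Matrix (Fin n) (Fin n) ℍ[ℝ]} {σ : Perm (Fin n)} {j : Fin n}
    (h : ∀ y z, σ.SameCycle j y → σ.SameCycle j z → star (A z y) = A y z) :
    cycleRe A (flipCycle σ j) = cycleRe A σ := by
  have hl : leaders (flipCycle σ j) = leaders σ := by
    ext x
    simp only [mem_leaders, sameCycle_flipCycle]
  rw [cycleRe, cycleRe, hl]
  refine Finset.prod_congr rfl fun x _ => ?_
  by_cases hx : σ.SameCycle j x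
  · rw [re_cycleProd_eq_of_sameCycle A ((sameCycle_flipCycle σ j j x).2 hx),
      cycleProd_flipCycle_self h, Quaternion.re_star, re_cycleProd_eq_of_sameCycle A hx]
  · rw [cycleProd_flipCycle_of_not_sameCycle A hx]

/-- Reversing the cycle `q` through `j` and averaging turns the merged cycle `b * q * p` into
`re q • (b * p)`, whose real part is the contribution of the two separate cycles. -/
theorem cycleRe_mul_swap_add_flipCycle {A : Matrix (Fin n) (Fin n) ℍ[ℝ]} {i j : Fin n} {b : ℍ[ℝ]}
    (hA : ∀ x y, x ≠ i → y ≠ i → star (A y x) = A x y) (hrow : ∀ y, A i y = b * A j y)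
    {σ : Perm (Fin n)} (h : ¬ σ.SameCycle i j) :
    cycleRe A (σ * swap i j) + cycleRe A (flipCycle σ j * swap i j) = 2 * cycleRe A σ := by
  classical
  have hne : ∀ y, σ.SameCycle j y → y ≠ i := fun y hy hyi => h (hyi ▸ hy.symm)
  have hH : ∀ y z, σ.SameCycle j y → σ.SameCycle j z → star (A z y) = A y z :=
    fun y z hy hz => hA y z (hne y hy) (hne z hz)
  have h' : ¬ (flipCycle σ j).SameCycle i j := fun h' => h ((sameCycle_flipCycle σ j i j).1 h')
  have hon := flipCycle_eq_on_of_not_sameCycle (fun h' => h h'.symm : ¬ σ.SameCycle j i)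
  have hp : A j (flipCycle σ j i) *
      walkProd A (flipCycle σ j) (flipCycle σ j i) (minimalPeriod (flipCycle σ j) i - 1) =
      A j (σ i) * walkProd A σ (σ i) (minimalPeriod σ i - 1) := by
    have hi : flipCycle σ j i = σ i := hon i (SameCycle.refl σ i)
    rw [hi, minimalPeriod_congr hon]
    congr 1
    have hk (k : ℕ) : (flipCycle σ j ^ k) (σ i) = (σ ^ k) (σ i) :=
      pow_apply_congr (fun y hy => hon y (sameCycle_apply_left.1 hy)) k
    exact walkProd_congr fun k _ => by rw [hk, hk]
  have hout : (∏ x ∈ leaders (flipCycle σ j),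
        if (flipCycle σ j).SameCycle i x ∨ (flipCycle σ j).SameCycle j x then 1
        else (cycleProd A (flipCycle σ j) x).re) =
      ∏ x ∈ leaders σ, if σ.SameCycle i x ∨ σ.SameCycle j x then 1
        else (cycleProd A σ x).re := by
    have hl : leaders (flipCycle σ j) = leaders σ := by
      ext x
      simp only [mem_leaders, sameCycle_flipCycle]
    rw [hl]
    refine Finset.prod_congr rfl fun x _ => ?_
    simp only [sameCycle_flipCycle]
    split_ifs with hx
    · rfl
    · rw [cycleProd_flipCycle_of_not_sameCycle A fun h => hx (Or.inr h)]
  rw [cycleRe_mul_swap A h, cycleRe_mul_swap A h', hout, cycleProd_mul_swap hrow h,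
    cycleProd_mul_swap hrow h', hp, cycleProd_flipCycle_self hH, cycleRe_eq_mul_mul_prod A h,
    cycleProd_eq_mul_walkProd A σ i, hrow, ← add_mul, ← Quaternion.re_add, ← add_mul, ← mul_add,
    Quaternion.self_add_star', Quaternion.mul_coe_eq_smul, smul_mul_assoc, Quaternion.re_smul,
    mul_assoc b, smul_eq_mul]
  ring

/-- A matrix that is Hermitian away from row and column `i` and whose row `i` is a left multiple
of another row has vanishing determinant. -/
theorem mooreDet_eq_zero_of_row_eq_mul {A : Matrix (Fin n) (Fin n) ℍ[ℝ]} {i j : Fin n} {b : ℍ[ℝ]}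
    (hij : i ≠ j) (hA : ∀ x y, x ≠ i → y ≠ i → star (A y x) = A x y)
    (hrow : ∀ y, A i y = b * A j y) : mooreDet A = 0 := by
  classical
  set f : Perm (Fin n) → ℝ := fun σ => ((sign σ : ℤ) : ℝ) * cycleRe A σ with hf
  have hjoin : ∑ σ : Perm (Fin n) with ¬ ¬ σ.SameCycle i j, f σ =
      ∑ σ : Perm (Fin n) with ¬ σ.SameCycle i j, f (σ * swap i j) := by
    refine Finset.sum_nbij' (· * swap i j) (· * swap i j) ?_ ?_ ?_ ?_ ?_
    · intro σ hσ
      simp only [Finset.mem_filter, Finset.mem_univ, true_and, not_not] at hσ ⊢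
      exact not_sameCycle_mul_swap hij hσ
    · intro σ hσ
      simp only [Finset.mem_filter, Finset.mem_univ, true_and, not_not] at hσ ⊢
      exact sameCycle_mul_swap hσ
    all_goals
      intro σ _
      simp [mul_assoc]
  rw [mooreDet, ← Finset.sum_filter_add_sum_filter_not _ fun σ => ¬ σ.SameCycle i j, hjoin,
    ← Finset.sum_add_distrib]
  have hcancel : ∀ σ ∈ ({σ | ¬ σ.SameCycle i j} : Finset (Perm (Fin n))),
      (f σ + f (σ * swap i j)) + (f (flipCycle σ j) + f (flipCycle σ j * swap i j)) = 0 := by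
    intro σ hσ
    have h : ¬ σ.SameCycle i j := by simpa using hσ
    have h1 := cycleRe_mul_swap_add_flipCycle hA hrow h
    have h2 : cycleRe A (flipCycle σ j) = cycleRe A σ := cycleRe_flipCycle fun y z hy hz =>
      hA y z (fun e => h (e ▸ hy.symm)) (fun e => h (e ▸ hz.symm))
    simp only [hf, Perm.sign_mul, sign_flipCycle, sign_swap hij, h2, Units.val_neg, mul_neg, mul_one, Int.cast_neg]
    linear_combination (-((sign σ : ℤ) : ℝ)) * h1
  refine Finset.sum_involution (fun σ _ => flipCycle σ j) hcancel (fun σ hσ hne hfix => hne ?_)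
    (fun σ hσ => ?_) (fun σ _ => flipCycle_flipCycle σ j)
  · have := hcancel σ hσ
    rw [hfix] at this
    linarith
  · simpa [sameCycle_flipCycle] using hσ

theorem one_add_single_mul_apply (i j : Fin n) (b : ℍ[ℝ]) (M : Matrix (Fin n) (Fin n) ℍ[ℝ])
    (x y : Fin n) :
    ((1 + Matrix.single i j b) * M) x y = M x y + if x = i then b * M j y else 0 := by
  rw [add_mul, one_mul, Matrix.add_apply]
  split_ifs with h
  · rw [h, Matrix.single_mul_apply_same]
  · rw [Matrix.single_mul_apply_of_ne _ _ _ _ _ h]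

theorem mul_one_add_single_conjTranspose_apply (i j : Fin n) (b : ℍ[ℝ])
    (M : Matrix (Fin n) (Fin n) ℍ[ℝ]) (x y : Fin n) :
    (M * (1 + Matrix.single i j b).conjTranspose) x y =
      M x y + if y = i then M x j * star b else 0 := by
  rw [Matrix.conjTranspose_add, Matrix.conjTranspose_one, Matrix.conjTranspose_single, mul_add,
    mul_one, Matrix.add_apply]
  split_ifs with h
  · rw [h, Matrix.mul_single_apply_same]
  · rw [Matrix.mul_single_apply_of_ne _ _ _ _ _ h]

/-- Adding a left multiple of row `j` to row `i` keeps the determinant, provided the matrix is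
Hermitian away from row and column `i`. -/
theorem mooreDet_one_add_single_mul {M : Matrix (Fin n) (Fin n) ℍ[ℝ]} {i j : Fin n} (hij : i ≠ j)
    (b : ℍ[ℝ]) (hM : ∀ x y, x ≠ i → y ≠ i → star (M y x) = M x y) :
    mooreDet ((1 + Matrix.single i j b) * M) = mooreDet M := by
  have hzero : mooreDet (M.updateRow i fun y => b * M j y) = 0 := by
    refine mooreDet_eq_zero_of_row_eq_mul (b := b) hij (fun x y hx hy => ?_) fun y => ?_
    · rw [Matrix.updateRow_ne hx, Matrix.updateRow_ne hy, hM x y hx hy]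
    · rw [Matrix.updateRow_self, Matrix.updateRow_ne hij.symm]
  rw [mooreDet_add_row (A := M) (B := M.updateRow i fun y => b * M j y) (i := i) _ _ _, hzero,
    add_zero]
  · intro y
    rw [one_add_single_mul_apply, if_pos rfl, Matrix.updateRow_self]
  · intro x hx y
    rw [one_add_single_mul_apply, if_neg hx, add_zero]
  · intro x hx y
    rw [one_add_single_mul_apply, if_neg hx, add_zero, Matrix.updateRow_ne hx]

theorem mooreDet_congruence_one_add_single {A : Matrix (Fin n) (Fin n) ℍ[ℝ]}
    (hA : A.IsHermitian) {i j : Fin n} (hij : i ≠ j) (b : ℍ[ℝ]) :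
    mooreDet ((1 + Matrix.single i j b) * A * (1 + Matrix.single i j b).conjTranspose) =
      mooreDet A := by
  rw [mul_assoc, mooreDet_one_add_single_mul hij, ← mooreDet_conjTranspose,
    Matrix.conjTranspose_mul, Matrix.conjTranspose_conjTranspose, hA.eq,
    mooreDet_one_add_single_mul hij]
  · exact fun x y _ _ => hA.apply x y
  · intro x y hx hy
    rw [mul_one_add_single_conjTranspose_apply, mul_one_add_single_conjTranspose_apply, if_neg hx,
      if_neg hy, add_zero, add_zero, hA.apply]

theorem mooreDet_congruence {U : (Matrix (Fin n) (Fin n) ℍ[ℝ])ˣ} (hU : U ∈ SL n) :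
    ∀ A : Matrix (Fin n) (Fin n) ℍ[ℝ], A.IsHermitian →
      mooreDet ((U : Matrix (Fin n) (Fin n) ℍ[ℝ]) * A *
        (U : Matrix (Fin n) (Fin n) ℍ[ℝ]).conjTranspose) = mooreDet A := by
  induction hU using Subgroup.closure_induction with
  | mem P hP =>
    obtain ⟨i, j, b, hij, hP⟩ := hP
    intro A hA
    rw [hP]
    exact mooreDet_congruence_one_add_single hA hij b
  | one => simp
  | mul U V _ _ hU hV =>
    intro A hA
    have h := hU _ (Matrix.isHermitian_mul_mul_conjTranspose (V : Matrix (Fin n) (Fin n) ℍ[ℝ]) hA)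
    rw [← hV A hA, ← h, Units.val_mul, Matrix.conjTranspose_mul]
    simp only [mul_assoc]
  | inv U _ hU =>
    intro A hA
    rw [← hU _ (Matrix.isHermitian_mul_mul_conjTranspose _ hA)]
    congr 1
    have h : (↑U⁻¹ : Matrix (Fin n) (Fin n) ℍ[ℝ]).conjTranspose *
        (U : Matrix (Fin n) (Fin n) ℍ[ℝ]).conjTranspose = 1 := by
      rw [← Matrix.conjTranspose_mul, Units.mul_inv, Matrix.conjTranspose_one]
    rw [mul_assoc, mul_assoc, mul_assoc, h, mul_one, Units.mul_inv_cancel_left]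

/-! ### Diagonalization by unimodular congruence -/

/-- The elementary matrix `1 + b E_{ij}`, `i ≠ j`, as an invertible matrix. -/
noncomputable def transvectionUnit (i j : Fin n) (hij : i ≠ j) (b : ℍ[ℝ]) :
    (Matrix (Fin n) (Fin n) ℍ[ℝ])ˣ where
  val := 1 + Matrix.single i j b
  inv := 1 + Matrix.single i j (-b)
  val_inv := by
    simp [mul_add, add_mul, Matrix.single_mul_single_of_ne _ _ _ _ hij.symm, add_assoc,
      ← Matrix.single_add]
  inv_val := by
    simp [mul_add, add_mul, Matrix.single_mul_single_of_ne _ _ _ _ hij.symm, add_assoc,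
      ← Matrix.single_add]

theorem transvectionUnit_mem_SL (i j : Fin n) (hij : i ≠ j) (b : ℍ[ℝ]) :
    transvectionUnit i j hij b ∈ SL n :=
  Subgroup.subset_closure ⟨i, j, b, hij, rfl⟩

/-- `B` arises from `A` by congruence with an element of `SL(n, ℍ)`. -/
def SLCongruent (A B : Matrix (Fin n) (Fin n) ℍ[ℝ]) : Prop :=
  ∃ U ∈ SL n, (U : Matrix (Fin n) (Fin n) ℍ[ℝ]) * A *
    (U : Matrix (Fin n) (Fin n) ℍ[ℝ]).conjTranspose = B

theorem SLCongruent.refl (A : Matrix (Fin n) (Fin n) ℍ[ℝ]) : SLCongruent A A :=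
  ⟨1, one_mem _, by simp⟩

theorem SLCongruent.trans {A B C : Matrix (Fin n) (Fin n) ℍ[ℝ]} (hAB : SLCongruent A B)
    (hBC : SLCongruent B C) : SLCongruent A C := by
  obtain ⟨U, hU, rfl⟩ := hAB
  obtain ⟨V, hV, rfl⟩ := hBC
  refine ⟨V * U, mul_mem hV hU, ?_⟩
  rw [Units.val_mul, Matrix.conjTranspose_mul]
  simp only [mul_assoc]

theorem SLCongruent.isHermitian {A B : Matrix (Fin n) (Fin n) ℍ[ℝ]} (h : SLCongruent A B)
    (hA : A.IsHermitian) : B.IsHermitian := by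
  obtain ⟨U, _, rfl⟩ := h
  exact Matrix.isHermitian_mul_mul_conjTranspose _ hA

/-- The off-diagonal entries in the rows with index in `S` vanish. -/
def IsDiagOn (A : Matrix (Fin n) (Fin n) ℍ[ℝ]) (S : Finset (Fin n)) : Prop :=
  ∀ i ∈ S, ∀ j, j ≠ i → A i j = 0

/-- Adding `b` times row `k` to row `l`, and correspondingly for columns. -/
theorem exists_slCongruent_add {A : Matrix (Fin n) (Fin n) ℍ[ℝ]} {S : Finset (Fin n)}
    (hA : A.IsHermitian) (hS : IsDiagOn A S) {k l : Fin n} (hlk : l ≠ k) (hk : k ∉ S) (hl : l ∉ S)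
    (b : ℍ[ℝ]) :
    ∃ B, SLCongruent A B ∧ B.IsHermitian ∧ IsDiagOn B S ∧
      B l l = A l l + b * A k l + (A l k + b * A k k) * star b ∧
      (∀ y, y ≠ l → B l y = A l y + b * A k y) ∧
      ∀ x y, x ≠ l → y ≠ l → B x y = A x y := by
  have hcong : SLCongruent A
      ((1 + Matrix.single l k b) * A * (1 + Matrix.single l k b).conjTranspose) :=
    ⟨transvectionUnit l k hlk b, transvectionUnit_mem_SL l k hlk b, rfl⟩
  refine ⟨_, hcong, hcong.isHermitian hA, fun i hi j hji => ?_, ?_, fun y hy => ?_,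
    fun x y hx hy => ?_⟩
  · have hil : i ≠ l := fun h => hl (h ▸ hi)
    have hik : k ≠ i := fun h => hk (h ▸ hi)
    simp only [mul_one_add_single_conjTranspose_apply, one_add_single_mul_apply, hil, if_false,
      add_zero, hS i hi j hji, hS i hi k hik, zero_mul, ite_self]
  · simp only [mul_one_add_single_conjTranspose_apply, one_add_single_mul_apply, if_true]
  · simp only [mul_one_add_single_conjTranspose_apply, one_add_single_mul_apply, if_true, hy,
      if_false, add_zero]
  · simp only [mul_one_add_single_conjTranspose_apply, one_add_single_mul_apply, hx, hy,
      if_false, add_zero]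

/-- A nonzero diagonal entry clears its column. -/
theorem exists_slCongruent_clear {A : Matrix (Fin n) (Fin n) ℍ[ℝ]} {S : Finset (Fin n)}
    (hA : A.IsHermitian) (hS : IsDiagOn A S) {k : Fin n} (hk : k ∉ S) (hkk : A k k ≠ 0)
    (T : Finset (Fin n)) :
    ∃ B, SLCongruent A B ∧ B.IsHermitian ∧ IsDiagOn B S ∧ B k k ≠ 0 ∧
      ∀ l ∈ T, l ≠ k → B l k = 0 := by
  induction T using Finset.induction_on with
  | empty => exact ⟨A, SLCongruent.refl A, hA, hS, hkk, by simp⟩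
  | insert l T _ ih =>
    obtain ⟨B, hAB, hB, hBS, hBk, hBT⟩ := ih
    by_cases hlk : l = k
    · exact ⟨B, hAB, hB, hBS, hBk, fun m hm hmk =>
        hBT m (Finset.mem_of_mem_insert_of_ne hm (hlk ▸ hmk)) hmk⟩
    by_cases hl : l ∈ S
    · refine ⟨B, hAB, hB, hBS, hBk, fun m hm hmk => ?_⟩
      rcases Finset.mem_insert.1 hm with rfl | hm
      · exact hBS m hl k (Ne.symm hmk)
      · exact hBT m hm hmk
    obtain ⟨C, hBC, hC, hCS, -, hCl, hCo⟩ :=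
      exists_slCongruent_add hB hBS hlk hk hl (-(B l k * (B k k)⁻¹))
    refine ⟨C, hAB.trans hBC, hC, hCS, ?_, fun m hm hmk => ?_⟩
    · rwa [hCo k k (Ne.symm hlk) (Ne.symm hlk)]
    · by_cases hml : m = l
      · rw [hml, hCl k (Ne.symm hlk), neg_mul, inv_mul_cancel_right₀ hBk, add_neg_cancel]
      · rw [hCo m k hml (Ne.symm hlk)]
        exact hBT m (Finset.mem_of_mem_insert_of_ne hm hml) hmk

theorem exists_slCongruent_insert {A : Matrix (Fin n) (Fin n) ℍ[ℝ]} {S : Finset (Fin n)}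
    (hA : A.IsHermitian) (hS : IsDiagOn A S) {k : Fin n} (hk : k ∉ S) (hkk : A k k ≠ 0) :
    ∃ B, SLCongruent A B ∧ B.IsHermitian ∧ IsDiagOn B (insert k S) := by
  obtain ⟨B, hAB, hB, hBS, -, hBk⟩ := exists_slCongruent_clear hA hS hk hkk Finset.univ
  refine ⟨B, hAB, hB, fun i hi j hji => ?_⟩
  rcases Finset.mem_insert.1 hi with rfl | hi
  · rw [← hB.apply, hBk j (Finset.mem_univ j) hji, star_zero]
  · exact hBS i hi j hji

/-- Off `S`, either all off-diagonal entries vanish, or a nonzero diagonal entry can be produced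
and used as a pivot. -/
theorem exists_slCongruent_isDiagOn_univ (A : Matrix (Fin n) (Fin n) ℍ[ℝ]) (S : Finset (Fin n))
    (hA : A.IsHermitian) (hS : IsDiagOn A S) :
    ∃ B, SLCongruent A B ∧ B.IsHermitian ∧ IsDiagOn B Finset.univ := by
  by_cases hdone : IsDiagOn A Finset.univ
  · exact ⟨A, SLCongruent.refl A, hA, hdone⟩
  -- It suffices to find a congruent matrix with a pivot outside `S`.
  suffices h : ∃ k ∉ S, ∃ B, SLCongruent A B ∧ B.IsHermitian ∧ IsDiagOn B S ∧ B k k ≠ 0 by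
    obtain ⟨k, hk, B, hAB, hB, hBS, hBk⟩ := h
    obtain ⟨C, hBC, hC, hCS⟩ := exists_slCongruent_insert hB hBS hk hBk
    obtain ⟨D, hCD, hD⟩ := exists_slCongruent_isDiagOn_univ C (insert k S) hC hCS
    exact ⟨D, (hAB.trans hBC).trans hCD, hD⟩
  simp only [IsDiagOn, not_forall] at hdone
  obtain ⟨k, -, l, hlk, hkl⟩ := hdone
  have hk : k ∉ S := fun h => hkl (hS k h l hlk)
  have hl : l ∉ S := fun h => hkl (by rw [← hA.apply, hS l h k hlk.symm, star_zero])
  by_cases hkk : A k k = 0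
  · by_cases hll : A l l = 0
    · obtain ⟨B, hAB, hB, hBS, hBl, -⟩ := exists_slCongruent_add hA hS hlk hk hl (A l k)
      refine ⟨l, hl, B, hAB, hB, hBS, ?_⟩
      -- The new diagonal entry is `2 * |A l k| ^ 2`.
      have hlk0 : A l k ≠ 0 := fun h => hkl (by rw [← hA.apply, h, star_zero])
      rw [hBl, hkk, hll, mul_zero, add_zero, zero_add, ← hA.apply k l, ← two_smul ℝ]
      exact smul_ne_zero two_ne_zero (mul_ne_zero hlk0 (star_ne_zero.2 hlk0))
    · exact ⟨l, hl, A, SLCongruent.refl A, hA, hS, hll⟩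
  · exact ⟨k, hk, A, SLCongruent.refl A, hA, hS, hkk⟩
termination_by Sᶜ.card
decreasing_by
  rw [Finset.compl_insert]
  exact Finset.card_erase_lt_of_mem (Finset.mem_compl.2 hk)

theorem exists_diagonal {A : Matrix (Fin n) (Fin n) ℍ[ℝ]} (hA : A.IsHermitian) :
    ∃ U ∈ SL n, ∃ μ : Fin n → ℝ,
      (U : Matrix (Fin n) (Fin n) ℍ[ℝ]) * A * (U : Matrix (Fin n) (Fin n) ℍ[ℝ]).conjTranspose =
        Matrix.diagonal (fun i => (μ i : ℍ[ℝ])) := by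
  obtain ⟨B, ⟨U, hU, hUB⟩, hB, hdiag⟩ :=
    exists_slCongruent_isDiagOn_univ A ∅ hA fun i hi => absurd hi (Finset.notMem_empty i)
  refine ⟨U, hU, fun i => (B i i).re, hUB.trans ?_⟩
  ext1 i j
  by_cases hij : i = j
  · rw [← hij, Matrix.diagonal_apply_eq]
    exact Quaternion.star_eq_self.1 (hB.apply i i)
  · rw [Matrix.diagonal_apply_ne _ hij, hdiag i (Finset.mem_univ i) j (Ne.symm hij)]

end QuatDet

theorem theorem7p3 (n : ℕ) (A : Matrix (Fin n) (Fin n) ℍ[ℝ]) (hA : A.IsHermitian) :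
    (∃ U ∈ QuatDet.SL n, ∃ μ : Fin n → ℝ,
      (U : Matrix (Fin n) (Fin n) ℍ[ℝ]) * A * (U : Matrix (Fin n) (Fin n) ℍ[ℝ]).conjTranspose =
        Matrix.diagonal (fun i => (μ i : ℍ[ℝ]))) ∧
    (∀ U ∈ QuatDet.SL n, ∀ μ : Fin n → ℝ,
      (U : Matrix (Fin n) (Fin n) ℍ[ℝ]) * A * (U : Matrix (Fin n) (Fin n) ℍ[ℝ]).conjTranspose =
        Matrix.diagonal (fun i => (μ i : ℍ[ℝ])) →
      ∀ i : Fin n, QuatDet.rdet A i = ((∏ k, μ k : ℝ) : ℍ[ℝ]) ∧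
        QuatDet.cdet A i = ((∏ k, μ k : ℝ) : ℍ[ℝ])) := by
  refine ⟨QuatDet.exists_diagonal hA, fun U hU μ h i => ?_⟩
  rw [QuatDet.rdet_eq_mooreDet hA, QuatDet.cdet_eq_mooreDet hA, ← QuatDet.mooreDet_congruence hU A hA,
    h, QuatDet.mooreDet_diagonal]
  exact ⟨rfl, rfl⟩
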